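/- Let $n\ge 2$ and let $\mathscr{C}_n$ be the set of all $n$-cycles in the symmetric group on $\{1,\dots,n\}$. For a permutation $\nu$ of $\{1,\dots,n\}$ let its degree (cyclic descent number) be $\deg(\nu)=\#\{i\in\{1,\dots,n\} : \nu(i)>\nu(i+1)\}$, where $i$ is taken modulo $n$, so that $\nu(n+1)=\nu(1)$. Let $N_{n,d}$ be the number of $\nu\in\mathscr{C}_n$ with $\deg(\nu)=d$. Then the mean $\mu_n$ and the variance $\sigma_n^2$ of $\deg(\nu)$, for $\nu$ chosen from $\mathscr{C}_n$ with respect to the uniform probability measure, are $$\mu_n=\frac{1}{(n-1)!}\sum_{d=1}^{n-2} d\,N_{n,d}=\frac n2-\frac1{n-1}\qquad(n\ge 3),$$ $$\sigma_n^2=\frac{1}{(n-1)!}\sum_{d=1}^{n-2}(d-\mu_n)^2N_{n,d}=\frac n{12}+\frac{n}{(n-1)^2(n-2)}\qquad(n\ge 5).$$ -/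

import Mathlib

namespace CycleDegree

open Classical in
/-- The set of all `n`-cycles among the permutations of an `n`-element set, for `n ≥ 2`: the
permutations that are a single cycle moving every point. -/
noncomputable def nCycles (n : ℕ) : Finset (Equiv.Perm (Fin n)) :=
  {ν : Equiv.Perm (Fin n) | ν.IsCycle ∧ ν.support = Finset.univ}

/-- The degree (cyclic descent number) of `ν`: the number of `i` with `ν i > ν (i + 1)`, where `i`
is taken modulo `n`. The permutation `finRotate n` is `i ↦ i + 1` modulo `n`. -/
def degree {n : ℕ} (ν : Equiv.Perm (Fin n)) : ℕ :=
  Finset.card {i : Fin n | ν i > ν (finRotate n i)}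

/-- The number `N_{n,d}` of `n`-cycles of degree `d`. -/
noncomputable def N (n d : ℕ) : ℕ :=
  Finset.card {ν ∈ nCycles n | degree ν = d}

/-- The discrete σ-algebra on the finite set of permutations of `Fin n`. -/
instance permMeasurableSpace (n : ℕ) : MeasurableSpace (Equiv.Perm (Fin n)) := ⊤

/-- The uniform probability measure on the set of `n`-cycles. -/
noncomputable def uniformCycle (n : ℕ) : MeasureTheory.Measure (Equiv.Perm (Fin n)) :=
  ProbabilityTheory.uniformOn (nCycles n : Set (Equiv.Perm (Fin n)))

/-- The average `μ_n` of `d` with weights `N_{n,d} / (n-1)!`, over `1 ≤ d ≤ n - 2`. -/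
noncomputable def meanDegree (n : ℕ) : ℝ :=
  1 / ((n - 1).factorial : ℝ) * ∑ d ∈ Finset.Icc 1 (n - 2), (d : ℝ) * (N n d : ℝ)

/-- The average `σ_n²` of `(d - μ_n)²` with weights `N_{n,d} / (n-1)!`, over `1 ≤ d ≤ n - 2`. -/
noncomputable def varDegree (n : ℕ) : ℝ :=
  1 / ((n - 1).factorial : ℝ) *
    ∑ d ∈ Finset.Icc 1 (n - 2), ((d : ℝ) - meanDegree n) ^ 2 * (N n d : ℝ)

end CycleDegree

/-!
Let `κ` be the signed cyclic distance: `κ a b` is the representative of `b - a` in `(0, n)`, minus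
`n / 2`, or `0` if `a = b`. It is antisymmetric with vanishing row sums, and the sum of
`κ (ν i) (ν (i + 1))` over `i` is `n * (deg ν - n / 2)`. The number of `n`-cycles that map `p x` to
`a x` for `k` indices `x`, with `p` and `a` injective, is `(n - k - 1)! * det (1 - A)`, where `A` is
the adjacency matrix of the arcs `p x ↦ a x`. Hence the first two moments are sums of products of
values of `κ` against such determinants. Since the row sums of `κ` vanish, only those terms of the
Leibniz expansion survive in which every `a x` is tied to some `p y`; they add up to `κ i (i + 1)`
for the mean and to the Pfaffian of `κ` on `i`, `i + 1`, `j`, `j + 1` for the covariances, and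
neither depends on `i` and `j`. The coincidences `j = i` and `j = i ± 1` contribute through the
row sums of `κ ^ 2`.
-/

namespace CycleDegree

open Equiv Equiv.Perm Finset Function

section CyclesOn

theorem sameCycle_map_of_forall_sameCycle_apply {α β : Type*} {f : Perm α} {g : Perm β}
    {r : α → β} (h : ∀ x, SameCycle g (r x) (r (f x))) {x y : α} (hxy : SameCycle f x y) :
    SameCycle g (r x) (r y) := by
  obtain ⟨i, rfl⟩ := hxy
  induction i with
  | zero => exact SameCycle.refl _ _
  | succ i ih =>
    rw [add_comm, zpow_one_add, Perm.mul_apply]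
    exact ih.trans (h _)
  | pred i ih =>
    refine ih.trans (SameCycle.symm ?_)
    have hf : f ((f ^ (-(i : ℤ) - 1)) x) = (f ^ (-(i : ℤ))) x := by
      rw [← Perm.mul_apply, ← zpow_one_add, add_sub_cancel]
    exact hf ▸ h _

variable {V : Type*} [Fintype V] [DecidableEq V] {s : Finset V} {p a : V} {ν : Perm V}

open Classical in
/-- The permutations that fix every point outside `s` and permute `s` in a single cycle. Unlike the
condition `IsCycle`, this allows `s` to be a singleton, with the identity as the only element. -/
noncomputable def cyclesOn (s : Finset V) : Finset (Perm V) :=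
  {ν : Perm V | ν.IsCycleOn s ∧ ∀ x ∉ s, ν x = x}

theorem mem_cyclesOn : ν ∈ cyclesOn s ↔ ν.IsCycleOn s ∧ ∀ x ∉ s, ν x = x := by
  simp [cyclesOn]

theorem mem_cyclesOn_of_sameCycle (hfix : ∀ x ∉ s, ν x = x)
    (hs : ∀ x ∈ s, ∀ y ∈ s, SameCycle ν x y) : ν ∈ cyclesOn s := by
  refine mem_cyclesOn.2 ⟨⟨ν.bijOn fun x => not_iff_not.1 ⟨fun h => ?_, fun h => ?_⟩, hs⟩, hfix⟩
  · rwa [ν.injective (hfix _ h)] at h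
  · rwa [hfix x h]

theorem swap_mul_mem_cyclesOn_insert (hp : p ∉ s) (ha : a ∈ s) (hν : ν ∈ cyclesOn s) :
    swap p a * ν ∈ cyclesOn (insert p s) := by
  obtain ⟨hcycle, hfix⟩ := mem_cyclesOn.1 hν
  have sameCycle_p : SameCycle (swap p a * ν) p a := ⟨1, by simp [hfix p hp]⟩
  have sameCycle_apply : ∀ x, SameCycle (swap p a * ν) x (ν x) := fun x => by
    by_cases hxp : ν x = p
    · rw [ν.injective (hxp.trans (hfix p hp).symm), hfix p hp]
    by_cases hxa : ν x = a
    · rw [← sameCycle_apply_left, Perm.mul_apply, hxa, swap_apply_right]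
      exact sameCycle_p
    · rw [← sameCycle_apply_left, Perm.mul_apply, swap_apply_of_ne_of_ne hxp hxa]
  have sameCycle_a : ∀ x ∈ insert p s, SameCycle (swap p a * ν) x a := fun x hx => by
    obtain rfl | hxs := mem_insert.1 hx
    · exact sameCycle_p
    · exact sameCycle_map_of_forall_sameCycle_apply (r := id) sameCycle_apply (hcycle.2 hxs ha)
  refine mem_cyclesOn_of_sameCycle (fun x hx => ?_) fun x hx y hy =>
    (sameCycle_a x hx).trans (sameCycle_a y hy).symm
  rw [mem_insert, not_or] at hx
  rw [Perm.mul_apply, hfix x hx.2, swap_apply_of_ne_of_ne hx.1 (ne_of_mem_of_not_mem ha hx.2).symm]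

theorem swap_apply_mul_mem_cyclesOn (hp : p ∉ s) (hν : ν ∈ cyclesOn (insert p s)) :
    swap p (ν p) * ν ∈ cyclesOn s := by
  obtain ⟨hcycle, hfix⟩ := mem_cyclesOn.1 hν
  -- The new permutation is the first-return map: a visit to `p` is replaced by the next point.
  have sameCycle_apply : ∀ x, SameCycle (swap p (ν p) * ν) (if x = p then ν p else x)
      (if ν x = p then ν p else ν x) := fun x => by
    by_cases hx : x = p
    · rw [if_pos hx, hx, ite_eq_right_iff.2 fun h => h.symm ▸ h.symm ▸ rfl]
    by_cases hxp : ν x = p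
    · rw [if_neg hx, if_pos hxp, ← sameCycle_apply_left, Perm.mul_apply, hxp, swap_apply_left]
    · rw [if_neg hx, if_neg hxp, ← sameCycle_apply_left, Perm.mul_apply,
        swap_apply_of_ne_of_ne hxp (ν.injective.ne hx)]
  refine mem_cyclesOn_of_sameCycle (fun x hx => ?_) fun x hx y hy => ?_
  · by_cases hxp : x = p
    · simp [hxp]
    have hxs : x ∉ insert p s := by simp [hxp, hx]
    have hνp : ν p ∈ insert p s := hcycle.1.mapsTo (mem_insert_self p s)
    rw [Perm.mul_apply, hfix x hxs,
      swap_apply_of_ne_of_ne hxp (ne_of_mem_of_not_mem hνp hxs).symm]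
  · have := sameCycle_map_of_forall_sameCycle_apply (r := fun x => if x = p then ν p else x)
      sameCycle_apply (hcycle.2 (mem_insert_of_mem hx) (mem_insert_of_mem hy))
    rwa [if_neg (ne_of_mem_of_not_mem hx hp), if_neg (ne_of_mem_of_not_mem hy hp)] at this

theorem filter_cyclesOn_insert (hp : p ∉ s) (ha : a ∈ s) :
    {ν ∈ cyclesOn (insert p s) | ν p = a} = (cyclesOn s).map (mulLeftEmbedding (swap p a)) := by
  ext ν
  simp only [mem_filter, mem_map, mulLeftEmbedding_apply]
  constructor
  · rintro ⟨hν, rfl⟩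
    exact ⟨_, swap_apply_mul_mem_cyclesOn hp hν, by simp [← mul_assoc]⟩
  · rintro ⟨μ, hμ, rfl⟩
    exact ⟨swap_mul_mem_cyclesOn_insert hp ha hμ, by simp [(mem_cyclesOn.1 hμ).2 p hp]⟩

theorem apply_mem_of_mem_cyclesOn_insert (hp : p ∉ s) (hs : s.Nonempty)
    (hν : ν ∈ cyclesOn (insert p s)) : ν p ∈ s := by
  have hcycle := (mem_cyclesOn.1 hν).1
  obtain ⟨x, hx⟩ := hs
  refine mem_of_mem_insert_of_ne (hcycle.1.mapsTo (mem_insert_self p s))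
    (hcycle.apply_ne ⟨p, mem_insert_self p s, x, mem_insert_of_mem hx, ?_⟩ (mem_insert_self p s))
  exact (ne_of_mem_of_not_mem hx hp).symm

theorem cyclesOn_singleton (p : V) : cyclesOn {p} = {1} := by
  ext ν
  rw [mem_cyclesOn, coe_singleton, isCycleOn_singleton, mem_singleton, Perm.ext_iff]
  refine ⟨fun ⟨hp, hfix⟩ x => ?_, fun h => ⟨h p, fun x _ => h x⟩⟩
  obtain rfl | hx := eq_or_ne x p
  · exact hp
  · exact hfix x (by simpa using hx)

theorem card_cyclesOn (hs : s.Nonempty) : #(cyclesOn s) = (#s - 1).factorial := by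
  induction hs using Finset.Nonempty.cons_induction with
  | singleton p => simp [cyclesOn_singleton]
  | cons p s hp hs ih =>
    rw [cons_eq_insert, card_insert_of_notMem hp, card_eq_sum_card_fiberwise (t := s)
      fun ν hν => apply_mem_of_mem_cyclesOn_insert hp hs hν]
    calc ∑ a ∈ s, #{ν ∈ cyclesOn (insert p s) | ν p = a} = ∑ _ ∈ s, #(cyclesOn s) :=
          sum_congr rfl fun a ha => by rw [filter_cyclesOn_insert hp ha, card_map]
      _ = (#s + 1 - 1).factorial := by
          rw [sum_const, smul_eq_mul, ih, Nat.mul_factorial_pred hs.card_ne_zero,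
            Nat.add_sub_cancel]

end CyclesOn

section ArcMatrix

variable {V R : Type*} [DecidableEq V] [CommRing R] {k : ℕ}

/-- The matrix `1 - A`, where `A` is the adjacency matrix, with rows and columns indexed by `ι`, of
the partial function on `V` with arcs `p x ↦ a x`. For injective `p` and `a` its determinant is `0`
if some of these arcs form a cycle, and `1` otherwise. -/
def arcMatrix (R : Type*) [CommRing R] {ι : Type*} [DecidableEq ι] (p a : ι → V) : Matrix ι ι R :=
  Matrix.of fun x y => (if x = y then 1 else 0) - if a x = p y then 1 else 0

theorem arcMatrix_apply {ι : Type*} [DecidableEq ι] (p a : ι → V) (x y : ι) :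
    arcMatrix R p a x y =
      (if x = y then 1 else 0) - if a x = p y then 1 else 0 := rfl

theorem det_arcMatrix_cons_self {p₀ : V} {p : Fin k → V}
    (hp : Injective (Fin.cons p₀ p : Fin (k + 1) → V)) (a : Fin k → V) :
    (arcMatrix R (Fin.cons p₀ p : Fin (k + 1) → V) (Fin.cons p₀ a)).det = 0 := by
  refine Matrix.det_eq_zero_of_row_eq_zero 0 fun y => ?_
  have hrow : p₀ = (Fin.cons p₀ p : Fin (k + 1) → V) y ↔ 0 = y := hp.eq_iff (a := 0)
  simp [arcMatrix_apply, hrow]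

theorem ite_swap_apply_eq {p₀ a₀ b q : V} (hb : b ≠ a₀) (hq : p₀ ≠ q) :
    (if swap p₀ a₀ b = q then 1 else 0 : R) =
      (if b = q then 1 else 0) + (if a₀ = q then 1 else 0) * if b = p₀ then 1 else 0 := by
  obtain rfl | hbp := eq_or_ne b p₀
  · simp [hq]
  · simp [swap_apply_of_ne_of_ne hbp hb, hbp]

theorem det_arcMatrix_cons {p₀ a₀ : V} {p a : Fin k → V} (h₀ : a₀ ≠ p₀) (hp : ∀ y, p₀ ≠ p y)
    (ha : ∀ x, a x ≠ a₀) :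
    (arcMatrix R (Fin.cons p₀ p : Fin (k + 1) → V) (Fin.cons a₀ a)).det =
      (arcMatrix R p fun x => swap p₀ a₀ (a x)).det := by
  set B := arcMatrix R (Fin.cons p₀ p : Fin (k + 1) → V) (Fin.cons a₀ a)
  let c : Fin (k + 1) → R := Fin.cons 0 fun y => if a₀ = p y then 1 else 0
  -- Adding multiples of column `0` clears the rest of row `0`.
  let C : Matrix (Fin (k + 1)) (Fin (k + 1)) R := Matrix.of fun x y => B x y + c y * B x 0
  have det_C : C.det = B.det := by
    rw [← Matrix.det_transpose C, ← Matrix.det_transpose B]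
    exact Matrix.det_eq_of_forall_row_eq_smul_add_const c 0 (by simp [c]) fun i j => rfl
  have C_zero_zero : C 0 0 = 1 := by simp [C, c, B, arcMatrix_apply, h₀]
  have C_zero_succ : ∀ y : Fin k, C 0 y.succ = 0 := fun y => by
    simp [C, c, B, arcMatrix_apply, h₀, eq_comm (a := (0 : Fin (k + 1)))]
  have C_succ_succ : C.submatrix Fin.succ Fin.succ = arcMatrix R p fun x => swap p₀ a₀ (a x) := by
    ext x y
    simp only [Matrix.submatrix_apply, Matrix.of_apply, C, c, B, arcMatrix_apply, Fin.cons_succ,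
      Fin.cons_zero, Fin.succ_inj, Fin.succ_ne_zero, if_false, ite_swap_apply_eq (ha x) (hp y)]
    ring
  rw [← det_C, Matrix.det_succ_row_zero, Fin.sum_univ_succ, sum_eq_zero fun y _ => by
    rw [C_zero_succ]; ring]
  simp [C_zero_zero, C_succ_succ]

theorem card_filter_cyclesOn [Fintype V] {s : Finset V} {p a : Fin k → V} (hp : Injective p)
    (ha : Injective a) (hps : ∀ x, p x ∈ s) (has : ∀ x, a x ∈ s) (hk : k < #s) :
    (#{ν ∈ cyclesOn s | ∀ x, ν (p x) = a x} : R) =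
      ((#s - k - 1).factorial : R) * (arcMatrix R p a).det := by
  induction k generalizing s with
  | zero => simp [card_cyclesOn (card_pos.1 hk)]
  | succ k ih =>
    obtain ⟨p₀, p, rfl⟩ : ∃ q₀ q, p = Fin.cons q₀ q := ⟨_, _, (Fin.cons_self_tail p).symm⟩
    obtain ⟨a₀, a, rfl⟩ : ∃ b₀ b, a = Fin.cons b₀ b := ⟨_, _, (Fin.cons_self_tail a).symm⟩
    obtain ⟨s, hp₀, rfl⟩ : ∃ t, p₀ ∉ t ∧ insert p₀ t = s :=
      ⟨s.erase p₀, notMem_erase p₀ s, insert_erase (hps 0)⟩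
    rw [card_insert_of_notMem hp₀] at hk ⊢
    simp only [Fin.forall_fin_succ, Fin.cons_zero, Fin.cons_succ] at hps has ⊢
    obtain rfl | ha₀ := eq_or_ne a₀ p₀
    · have hs : s.Nonempty := card_pos.1 (by omega)
      rw [det_arcMatrix_cons_self hp, mul_zero, filter_false_of_mem, card_empty, Nat.cast_zero]
      exact fun ν hν h =>
        hp₀ (h.1 ▸ apply_mem_of_mem_cyclesOn_insert hp₀ hs hν)
    obtain ⟨hpne, hp⟩ := Fin.cons_injective_iff.1 hp
    obtain ⟨hane, ha⟩ := Fin.cons_injective_iff.1 ha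
    have hpp : ∀ x, p₀ ≠ p x := fun x h => hpne ⟨x, h.symm⟩
    have haa : ∀ x, a x ≠ a₀ := fun x h => hane ⟨x, h⟩
    have ha₀s : a₀ ∈ s := mem_of_mem_insert_of_ne has.1 ha₀
    have hswap : ∀ x, swap p₀ a₀ (a x) ∈ s := fun x => by
      obtain h | h := eq_or_ne (a x) p₀
      · rwa [h, swap_apply_left]
      · rw [swap_apply_of_ne_of_ne h (haa x)]
        exact mem_of_mem_insert_of_ne (has.2 x) h
    rw [det_arcMatrix_cons ha₀ hpp haa, ← filter_filter, filter_cyclesOn_insert hp₀ ha₀s,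
      filter_map, card_map, show #s + 1 - (k + 1) - 1 = #s - k - 1 by omega,
      ← ih hp (a := fun x => swap p₀ a₀ (a x)) ((swap p₀ a₀).injective.comp ha)
        (fun x => mem_of_mem_insert_of_ne (hps.2 x) (hpp x).symm) hswap (by omega)]
    simp only [comp_def, mulLeftEmbedding_apply, Perm.mul_apply, swap_apply_eq_iff]

theorem sum_cyclesOn_comp [Fintype V] {p : Fin k → V} (hp : Injective p)
    (hk : k < Fintype.card V) (F : (Fin k → V) → R) :
    ∑ ν ∈ cyclesOn univ, F (fun x => ν (p x)) = ((Fintype.card V - k - 1).factorial : R) *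
      ∑ a with Injective a, F a * (arcMatrix R p a).det := by
  rw [← sum_fiberwise_of_maps_to (t := {a : Fin k → V | Injective a})
    (g := fun (ν : Perm V) x => ν (p x)) fun ν _ =>
      mem_filter.2 ⟨mem_univ _, ν.injective.comp hp⟩, mul_sum]
  refine sum_congr rfl fun a ha => ?_
  have hcard := card_filter_cyclesOn (R := R) (s := univ) hp (mem_filter.1 ha).2 (by simp)
    (by simp) (by simpa using hk)
  rw [sum_congr rfl fun ν hν => by rw [(mem_filter.1 hν).2], sum_const, nsmul_eq_mul]
  simp only [funext_iff, hcard, card_univ]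
  ring

end ArcMatrix

section TupleSums

theorem injective_fin_three_iff {V : Type*} {a b c : V} :
    Injective ![a, b, c] ↔ a ≠ b ∧ a ≠ c ∧ b ≠ c := by
  rw [Matrix.vecCons, Fin.cons_injective_iff, injective_pair_iff_ne]
  grind [Matrix.range_cons, Matrix.range_empty]

theorem injective_fin_four_iff {V : Type*} {a b c d : V} :
    Injective ![a, b, c, d] ↔ a ≠ b ∧ a ≠ c ∧ a ≠ d ∧ b ≠ c ∧ b ≠ d ∧ c ≠ d := by
  rw [Matrix.vecCons, Fin.cons_injective_iff, injective_fin_three_iff]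
  grind [Matrix.range_cons, Matrix.range_empty]

variable {V M : Type*} [Fintype V]

theorem sum_fin_succ_pi [AddCommMonoid M] {k : ℕ} (F : (Fin (k + 1) → V) → M) :
    ∑ a, F a = ∑ x, ∑ a : Fin k → V, F (Fin.cons x a) := by
  rw [← (Fin.consEquiv fun _ => V).sum_comp, Fintype.sum_prod_type]
  rfl

theorem sum_fin_zero_pi [AddCommMonoid M] (F : (Fin 0 → V) → M) : ∑ a, F a = F ![] :=
  (Fintype.sum_unique F).trans (congrArg F (Subsingleton.elim _ _))

theorem sum_fin_two_pi [AddCommMonoid M] (F : (Fin 2 → V) → M) :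
    ∑ a, F a = ∑ a, ∑ b, F ![a, b] := by
  simp only [sum_fin_succ_pi, sum_fin_zero_pi]
  rfl

theorem sum_fin_three_pi [AddCommMonoid M] (F : (Fin 3 → V) → M) :
    ∑ a, F a = ∑ a, ∑ b, ∑ c, F ![a, b, c] := by
  simp only [sum_fin_succ_pi, sum_fin_zero_pi]
  rfl

theorem sum_fin_four_pi [AddCommMonoid M] (F : (Fin 4 → V) → M) :
    ∑ a, F a = ∑ a, ∑ b, ∑ c, ∑ d, F ![a, b, c, d] := by
  simp only [sum_fin_succ_pi, sum_fin_zero_pi]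
  rfl

variable [DecidableEq V]

theorem sum_injective_fin_two [AddCommMonoid M] {F : (Fin 2 → V) → M} (hF : ∀ a, F ![a, a] = 0) :
    ∑ a with Injective a, F a = ∑ a, F a := by
  refine sum_filter_of_ne fun a _ ha => ?_
  obtain ⟨x, y, rfl⟩ : ∃ x y, a = ![x, y] := ⟨a 0, a 1, by ext i; fin_cases i <;> rfl⟩
  exact injective_pair_iff_ne.2 fun h => ha (h ▸ hF x)

variable [AddCommGroup M]

theorem sum_injective_fin_three {F : (Fin 3 → V) → M} (h₀₁ : ∀ a c, F ![a, a, c] = 0)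
    (h₁₂ : ∀ a b, F ![a, b, b] = 0) :
    ∑ a with Injective a, F a = ∑ a, F a - ∑ a, ∑ b, F ![a, b, a] := by
  have indicator_eq : ∀ a b c, (if Injective ![a, b, c] then F ![a, b, c] else 0) =
      F ![a, b, c] - if c = a then F ![a, b, c] else 0 := fun a b c => by
    simp only [injective_fin_three_iff]
    obtain rfl | hab := eq_or_ne a b
    · simp [h₀₁]
    obtain rfl | hbc := eq_or_ne b c
    · simp [h₁₂]
    by_cases hca : c = a <;> simp [hab, hbc, hca, eq_comm (a := a)]
  simp only [sum_filter, sum_fin_three_pi, indicator_eq, sum_sub_distrib, sum_ite_eq', mem_univ,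
    if_true]

theorem sum_injective_fin_four {F : (Fin 4 → V) → M} (h₀₁ : ∀ a c d, F ![a, a, c, d] = 0)
    (h₂₃ : ∀ a b c, F ![a, b, c, c] = 0) :
    ∑ a with Injective a, F a = ∑ a, F a -
      (∑ a, ∑ b, ∑ d, F ![a, b, a, d] + ∑ a, ∑ b, ∑ c, F ![a, b, c, a] +
        ∑ a, ∑ b, ∑ d, F ![a, b, b, d] + ∑ a, ∑ b, ∑ c, F ![a, b, c, b]) +
      (∑ a, ∑ b, F ![a, b, a, b] + ∑ a, ∑ b, F ![a, b, b, a]) := by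
  have indicator_eq : ∀ a b c d, (if Injective ![a, b, c, d] then F ![a, b, c, d] else 0) =
      F ![a, b, c, d] - ((if c = a then F ![a, b, c, d] else 0) +
        (if d = a then F ![a, b, c, d] else 0) + (if c = b then F ![a, b, c, d] else 0) +
        (if d = b then F ![a, b, c, d] else 0)) +
      ((if c = a then if d = b then F ![a, b, c, d] else 0 else 0) +
        (if c = b then if d = a then F ![a, b, c, d] else 0 else 0)) := fun a b c d => by
    simp only [injective_fin_four_iff]
    obtain rfl | hab := eq_or_ne a b
    · simp [h₀₁]
    obtain rfl | hcd := eq_or_ne c d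
    · simp [h₂₃]
    have := hab.symm
    have := hcd.symm
    split_ifs <;> grind
  simp only [sum_filter, sum_fin_four_pi, indicator_eq, sum_sub_distrib, sum_add_distrib,
    sum_ite_eq', sum_ite_irrel, sum_const_zero, mem_univ, if_true]

end TupleSums

section DeterminantSums

variable {V R : Type*} [DecidableEq V] [CommRing R]

theorem arcMatrix_update {ι : Type*} [DecidableEq ι] (p a : ι → V) (i : ι) (d : V) :
    arcMatrix R p (update a i d) = (arcMatrix R p a).updateRow i
      fun y => (if i = y then 1 else 0) - if d = p y then 1 else 0 := by
  ext x y
  obtain rfl | h := eq_or_ne x i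
  · simp [arcMatrix_apply]
  · simp [arcMatrix_apply, h]

theorem det_arcMatrix_four_sub_antisymm (p : Fin 4 → V) (a b : V) :
    (arcMatrix R p ![a, b, a, b]).det - (arcMatrix R p ![a, b, b, a]).det =
      -((arcMatrix R p ![b, a, b, a]).det - (arcMatrix R p ![b, a, a, b]).det) := by
  let δ (x : V) (y : Fin 4) : R := if x = p y then 1 else 0
  have arcMatrix_eq : ∀ x y z t, arcMatrix R p ![x, y, z, t] =
      !![1 - δ x 0, -δ x 1, -δ x 2, -δ x 3;
        -δ y 0, 1 - δ y 1, -δ y 2, -δ y 3;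
        -δ z 0, -δ z 1, 1 - δ z 2, -δ z 3;
        -δ t 0, -δ t 1, -δ t 2, 1 - δ t 3] := fun x y z t => by
    ext i j
    fin_cases i <;> fin_cases j <;> simp [δ, arcMatrix_apply] <;> rfl
  simp only [arcMatrix_eq]
  simp only [Matrix.det_succ_row_zero, Nat.succ_eq_add_one, Nat.reduceAdd, Matrix.of_apply,
    Matrix.cons_val', Matrix.cons_val_fin_one, Matrix.cons_val_zero, Matrix.submatrix_apply,
    Fin.succ_zero_eq_one, Fin.succAbove, Matrix.cons_val_one, Matrix.submatrix_submatrix,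
    comp_apply, Fin.succ_one_eq_two, Matrix.cons_val, Matrix.det_unique, Fin.default_eq_zero,
    Fin.reduceSucc, Fin.castSucc_zero, Fin.sum_univ_succ, Fin.coe_ofNat_eq_mod, Nat.zero_mod,
    pow_zero, one_mul, lt_self_iff_false, if_false, if_true, Fin.castSucc_one, univ_unique,
    Fin.val_succ, Fin.val_eq_zero, zero_add, pow_one, Fin.castSucc_succ, Fin.succ_pos,
    sum_singleton, not_lt_zero, Fin.reduceCastSucc, Fin.reduceLT, Matrix.cons_val_succ,
    Fin.lt_one_iff, Fin.reduceEq]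
  ring

variable [Fintype V]

/-- Each term of the expanded product that keeps some `s i` does not involve `a i`, so it is killed
by the vanishing marginals of `w`. -/
theorem sum_mul_prod_sub_ite {k : ℕ} {w : (Fin k → V) → R}
    (hw : ∀ i a, ∑ x, w (update a i x) = 0) (s : Fin k → R) (u : Fin k → V) :
    ∑ a, w a * ∏ i, (s i - if a i = u i then 1 else 0) = (-1) ^ k * w u := by
  induction k with
  | zero => simp [Subsingleton.elim u default]
  | succ k ih =>
    have htail : ∀ x i (a : Fin k → V), ∑ y, w (Fin.cons x (update a i y)) = 0 := fun x i a => by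
      simpa only [Fin.cons_update] using hw i.succ (Fin.cons x a)
    have hzero : ∑ x, w (Fin.cons x (Fin.tail u)) = 0 := by
      simpa only [Fin.update_cons_zero] using hw 0 (Fin.cons (u 0) (Fin.tail u))
    calc ∑ a, w a * ∏ i, (s i - if a i = u i then 1 else 0)
        = ∑ x, (s 0 - if x = u 0 then 1 else 0) * ((-1) ^ k * w (Fin.cons x (Fin.tail u))) := by
          rw [sum_fin_succ_pi]
          refine sum_congr rfl fun x _ => ?_
          rw [← ih (w := fun a => w (Fin.cons x a)) (htail x) (Fin.tail s) (Fin.tail u), mul_sum]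
          refine sum_congr rfl fun a _ => ?_
          rw [Fin.prod_univ_succ]
          exact mul_left_comm _ _ _
      _ = (-1) ^ k * (s 0 * ∑ x, w (Fin.cons x (Fin.tail u)) - w u) := by
          rw [mul_sub, mul_left_comm, mul_sum, mul_sum]
          simp only [sub_mul, sum_sub_distrib, ite_mul, one_mul, zero_mul, sum_ite_eq', mem_univ,
            if_true, Fin.cons_self_tail]
      _ = (-1) ^ (k + 1) * w u := by rw [hzero]; ring

theorem sum_mul_det_arcMatrix {k : ℕ} {w : (Fin k → V) → R}
    (hw : ∀ i a, ∑ x, w (update a i x) = 0) (p : Fin k → V) :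
    ∑ a, w a * (arcMatrix R p a).det =
      (-1) ^ k * ∑ σ : Perm (Fin k), ((sign σ : ℤ) : R) * w fun i => p (σ i) := by
  simp only [← Matrix.det_transpose (arcMatrix R p _), Matrix.det_apply', mul_sum]
  rw [sum_comm]
  refine sum_congr rfl fun σ _ => ?_
  rw [mul_left_comm, ← sum_mul_prod_sub_ite hw (fun i => if i = σ i then 1 else 0), mul_sum]
  exact sum_congr rfl fun a _ => mul_left_comm _ _ _

variable {ι : Type*} [Fintype ι] [DecidableEq ι]

theorem sum_mul_det_updateRow (p : ι → V) (A : Matrix ι ι R) (i : ι) {w : V → R}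
    (hw : ∑ d, w d = 0) :
    ∑ d, w d * (A.updateRow i fun y => (if i = y then 1 else 0) - if d = p y then 1 else 0).det =
      (A.updateRow i fun y => -w (p y)).det := by
  have hrow : (fun y => -w (p y)) =
      ∑ d, w d • fun y => (if i = y then 1 else 0) - if d = p y then 1 else 0 := by
    ext y
    simp [Finset.sum_apply, mul_sub, hw]
  rw [hrow]
  simp only [← Matrix.det_updateRow_smul]
  exact (Matrix.detRowAlternating.toMultilinearMap.map_update_sum univ i _ A).symm

theorem sum_sum_mul_det_arcMatrix_update_update (p a : ι → V) {i j : ι} (hij : i ≠ j) {w : V → R}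
    (hw : ∑ d, w d = 0) :
    ∑ b, ∑ d, w b * w d * (arcMatrix R p (update (update a i b) j d)).det = 0 := by
  have inner_sum : ∀ b, ∑ d, w b * w d * (arcMatrix R p (update (update a i b) j d)).det =
      w b * (((arcMatrix R p a).updateRow j fun y => -w (p y)).updateRow i
        fun y => (if i = y then 1 else 0) - if b = p y then 1 else 0).det := fun b => by
    rw [Matrix.updateRow_comm _ hij.symm, ← arcMatrix_update, ← sum_mul_det_updateRow p _ j hw,
      mul_sum]
    simp only [arcMatrix_update, mul_assoc]
  -- Summing over `b` and `d` turns both rows `i` and `j` into `-w ∘ p`.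
  rw [sum_congr rfl fun b _ => inner_sum b, sum_mul_det_updateRow p _ i hw]
  exact Matrix.det_zero_of_row_eq hij (by ext y; simp [Matrix.updateRow_ne hij.symm])

theorem sum_sum_mul_det_arcMatrix_two {g : V → V → R} {H : R} (hg : ∀ a b, g a b = g b a)
    (hH : ∀ a, ∑ b, g a b = H) (p : Fin 2 → V) :
    ∑ a, ∑ b, g a b * (arcMatrix R p ![a, b]).det = (Fintype.card V - 2) * H := by
  have hH' : ∀ b, ∑ a, g a b = H := fun b => by rw [← hH b]; simp only [hg b]
  have det_eq : ∀ a b, (arcMatrix R p ![a, b]).det =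
      1 - (if a = p 0 then 1 else 0) - (if b = p 1 then 1 else 0)
        + (if a = p 0 then 1 else 0) * (if b = p 1 then 1 else 0)
        - (if a = p 1 then 1 else 0) * (if b = p 0 then 1 else 0) := fun a b => by
    have arcMatrix_eq : arcMatrix R p ![a, b] =
        !![1 - if a = p 0 then 1 else 0, -if a = p 1 then 1 else 0;
          -if b = p 0 then 1 else 0, 1 - if b = p 1 then 1 else 0] := by
      ext i j
      fin_cases i <;> fin_cases j <;> simp [arcMatrix_apply] <;> rfl
    rw [arcMatrix_eq, Matrix.det_fin_two_of]
    ring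
  simp only [det_eq, mul_sub, mul_add, mul_ite, mul_one, mul_zero, sum_sub_distrib,
    sum_add_distrib, sum_ite_eq', sum_ite_irrel, sum_const_zero, mem_univ, if_true, hH, hH',
    hg (p 1) (p 0), sum_const, card_univ, nsmul_eq_mul]
  ring

theorem sum_sum_mul_det_arcMatrix_three {g : V → V → R} {H : R} (hg : ∀ a b, g a b = g b a)
    (hH : ∀ a, ∑ b, g a b = H) (p : Fin 3 → V) :
    ∑ a, ∑ b, g a b * (arcMatrix R p ![a, b, a]).det = (Fintype.card V - 3) * H := by
  have hH' : ∀ b, ∑ a, g a b = H := fun b => by rw [← hH b]; simp only [hg b]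
  have det_eq : ∀ a b, (arcMatrix R p ![a, b, a]).det =
      1 - (if a = p 0 then 1 else 0) - (if a = p 2 then 1 else 0) - (if b = p 1 then 1 else 0)
        + (if a = p 0 then 1 else 0) * (if b = p 1 then 1 else 0)
        - (if a = p 1 then 1 else 0) * (if b = p 0 then 1 else 0)
        + (if a = p 2 then 1 else 0) * (if b = p 1 then 1 else 0)
        - (if a = p 1 then 1 else 0) * (if b = p 2 then 1 else 0) := fun a b => by
    let δ (x : V) (y : Fin 3) : R := if x = p y then 1 else 0
    have arcMatrix_eq : arcMatrix R p ![a, b, a] =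
        !![1 - δ a 0, -δ a 1, -δ a 2; -δ b 0, 1 - δ b 1, -δ b 2;
          -δ a 0, -δ a 1, 1 - δ a 2] := by
      ext i j
      fin_cases i <;> fin_cases j <;> simp [δ, arcMatrix_apply] <;> rfl
    rw [arcMatrix_eq, Matrix.det_fin_three]
    change _ = 1 - δ a 0 - δ a 2 - δ b 1 + δ a 0 * δ b 1 - δ a 1 * δ b 0 + δ a 2 * δ b 1
      - δ a 1 * δ b 2
    simp only [Matrix.of_apply, Matrix.cons_val', Matrix.cons_val_zero, Matrix.cons_val_fin_one,
      Matrix.cons_val_one, Matrix.cons_val]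
    ring
  simp only [det_eq, mul_sub, mul_add, mul_ite, mul_one, mul_zero, sum_sub_distrib,
    sum_add_distrib, sum_ite_eq', sum_ite_irrel, sum_const_zero, mem_univ, if_true, hH, hH',
    hg (p 1) (p 0), hg (p 1) (p 2), sum_const, card_univ, nsmul_eq_mul]
  ring

end DeterminantSums

section Kernels

theorem cast_factorial_sub_sub_one_mul {R : Type*} [CommRing R] {k n : ℕ} (hk : k < n) :
    ((n - k - 1).factorial : R) * ((n : R) - k) = ((n - k).factorial : R) := by
  rw [← Nat.cast_sub hk.le, ← Nat.cast_mul, mul_comm, Nat.mul_factorial_pred (by omega)]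

theorem sum_perm_fin_succ {k : ℕ} {M : Type*} [AddCommMonoid M] (f : Perm (Fin (k + 1)) → M) :
    ∑ σ, f σ = ∑ x, ∑ σ, f (decomposeFin.symm (x, σ)) := by
  rw [← decomposeFin.symm.sum_comp, Fintype.sum_prod_type]

variable {V R : Type*} [Fintype V] [CommRing R]

theorem sum_sum_mul_eq_zero_of_symm_of_antisymm {g h : V → V → R} (hg : ∀ a b, g a b = g b a)
    (hh : ∀ a b, h a b = -h b a) (hg_self : ∀ a, g a a = 0) :
    ∑ a, ∑ b, g a b * h a b = 0 := by
  rw [← Fintype.sum_prod_type' (f := fun a b => g a b * h a b)]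
  refine sum_involution (fun x _ => x.swap) (fun x _ => ?_) (fun x _ hx h_swap => hx ?_)
    (fun _ _ => mem_univ _) fun x _ => x.swap_swap
  · dsimp only [Prod.fst_swap, Prod.snd_swap]
    rw [hg x.1 x.2, hh x.1 x.2]
    ring
  · rw [← (Prod.ext_iff.1 h_swap).1, Prod.fst_swap, hg_self, zero_mul]

/-- An alternating function `κ` of two points whose sum over either argument is zero. The signed
cyclic distance `cycDist` is the example of interest. -/
structure IsBalancedKernel (κ : V → V → R) : Prop where
  self : ∀ x, κ x x = 0
  antisymm : ∀ x y, κ x y = -κ y x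
  sum_right : ∀ x, ∑ y, κ x y = 0

namespace IsBalancedKernel

variable {κ : V → V → R} (hκ : IsBalancedKernel κ)
include hκ

theorem sum_left (y : V) : ∑ x, κ x y = 0 := by
  simp only [hκ.antisymm _ y, sum_neg_distrib, hκ.sum_right, neg_zero]

variable [DecidableEq V]

theorem sum_mul_det_arcMatrix_two (p : Fin 2 → V) :
    ∑ a : Fin 2 → V, κ (a 0) (a 1) * (arcMatrix R p a).det = 2 * κ (p 0) (p 1) := by
  have marginals : ∀ i (a : Fin 2 → V), ∑ x, κ (update a i x 0) (update a i x 1) = 0 :=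
    fun i a => by fin_cases i <;> simp [hκ.sum_left, hκ.sum_right]
  rw [sum_mul_det_arcMatrix marginals]
  simp only [sum_perm_fin_succ, Nat.succ_eq_add_one, Nat.reduceAdd, univ_unique, default_eq,
    decomposeFin.symm_sign, decomposeFin_symm_apply_zero, decomposeFin_symm_apply_one,
    sum_singleton, Perm.sign_one, Perm.coe_one, id_eq, Fin.succ_zero_eq_one, Fin.sum_univ_succ,
    if_true, if_false, Units.val_one, Int.cast_one, swap_self, refl_apply, Fin.default_eq_zero,
    Fin.succ_ne_zero, Units.val_neg, Int.cast_neg, one_mul, neg_mul, swap_apply_right,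
    hκ.antisymm (p 1)]
  ring

theorem sum_mul_det_arcMatrix_four (p : Fin 4 → V) :
    ∑ a : Fin 4 → V, κ (a 0) (a 1) * κ (a 2) (a 3) * (arcMatrix R p a).det =
      8 * (κ (p 0) (p 1) * κ (p 2) (p 3) - κ (p 0) (p 2) * κ (p 1) (p 3)
        + κ (p 0) (p 3) * κ (p 1) (p 2)) := by
  have marginals : ∀ i (a : Fin 4 → V), ∑ x, κ (update a i x 0) (update a i x 1) *
      κ (update a i x 2) (update a i x 3) = 0 := fun i a => by
    fin_cases i <;> simp [← sum_mul, ← mul_sum, hκ.sum_left, hκ.sum_right]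
  have decomposeFin_two : ∀ {n} (x : Fin (n + 3)) σ,
      decomposeFin.symm (x, σ) 2 = Equiv.swap 0 x (σ 1).succ :=
    fun x σ => decomposeFin_symm_apply_succ σ x 1
  have decomposeFin_three : ∀ {n} (x : Fin (n + 4)) σ,
      decomposeFin.symm (x, σ) 3 = Equiv.swap 0 x (σ 2).succ :=
    fun x σ => decomposeFin_symm_apply_succ σ x 2
  rw [sum_mul_det_arcMatrix marginals]
  simp only [sum_perm_fin_succ, Nat.succ_eq_add_one, Nat.reduceAdd, decomposeFin.symm_sign,
    ite_mul, one_mul, neg_mul, decomposeFin_symm_apply_zero, decomposeFin_symm_apply_one,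
    swap_apply_def, Fin.succ_ne_zero, if_true, if_false, decomposeFin_two, decomposeFin_three,
    univ_unique, default_eq, sum_singleton, Perm.sign_one, Perm.coe_one, id_eq,
    Fin.succ_zero_eq_one, Fin.sum_univ_succ, one_ne_zero, Fin.succ_one_eq_two,
    Fin.default_eq_zero, Fin.reduceEq, Fin.reduceSucc, Units.val_one, Int.cast_one,
    Units.val_neg, Int.cast_neg, hκ.antisymm (p 1) (p 0), hκ.antisymm (p 2) (p 0),
    hκ.antisymm (p 3) (p 0), hκ.antisymm (p 2) (p 1), hκ.antisymm (p 3) (p 1),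
    hκ.antisymm (p 3) (p 2)]
  ring

theorem sum_sum_mul_mul_det_arcMatrix_eq_zero {k : ℕ} (p : Fin k → V) {F : V → V → Fin k → V}
    {i j : Fin k} (hij : i ≠ j) (a : V) (hF : ∀ b d, F b d = update (update (fun _ => a) i b) j d) :
    ∑ b, ∑ d, κ a b * κ a d * (arcMatrix R p (F b d)).det = 0 := by
  simpa only [hF] using sum_sum_mul_det_arcMatrix_update_update p _ hij (hκ.sum_right a)

theorem sum_sum_sq_mul_det_sub_det_eq_zero (p : Fin 4 → V) :
    ∑ a, ∑ b, κ a b ^ 2 *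
      ((arcMatrix R p ![a, b, a, b]).det - (arcMatrix R p ![a, b, b, a]).det) = 0 :=
  sum_sum_mul_eq_zero_of_symm_of_antisymm (fun a b => by rw [hκ.antisymm, neg_sq])
    (det_arcMatrix_four_sub_antisymm p) fun a => by rw [hκ.self, zero_pow two_ne_zero]

theorem sum_injective_mul_det_arcMatrix_four (p : Fin 4 → V) :
    ∑ a : Fin 4 → V with Injective a, κ (a 0) (a 1) * κ (a 2) (a 3) * (arcMatrix R p a).det =
      8 * (κ (p 0) (p 1) * κ (p 2) (p 3) - κ (p 0) (p 2) * κ (p 1) (p 3)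
        + κ (p 0) (p 3) * κ (p 1) (p 2)) := by
  have update_eq : ∀ a b d : V, ![a, b, a, d] = update (update (fun _ => a) 1 b) 3 d ∧
      ![a, b, d, a] = update (update (fun _ => a) 1 b) 2 d ∧
      ![b, a, a, d] = update (update (fun _ => a) 0 b) 3 d ∧
      ![b, a, d, a] = update (update (fun _ => a) 0 b) 2 d := fun a b d => by
    refine ⟨?_, ?_, ?_, ?_⟩ <;> ext i <;> fin_cases i <;> rfl
  have h₀₂ : ∑ a, ∑ b, ∑ d, κ a b * κ a d * (arcMatrix R p ![a, b, a, d]).det = 0 :=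
    sum_eq_zero fun a _ => hκ.sum_sum_mul_mul_det_arcMatrix_eq_zero p (by decide) a
      fun b d => (update_eq a b d).1
  have h₀₃ : ∑ a, ∑ b, ∑ c, κ a b * κ c a * (arcMatrix R p ![a, b, c, a]).det = 0 := by
    refine sum_eq_zero fun a _ => ?_
    simp only [hκ.antisymm _ a, mul_neg, neg_mul, sum_neg_distrib, neg_eq_zero]
    exact hκ.sum_sum_mul_mul_det_arcMatrix_eq_zero p (by decide) a fun b d => (update_eq a b d).2.1
  have h₁₂ : ∑ a, ∑ b, ∑ d, κ a b * κ b d * (arcMatrix R p ![a, b, b, d]).det = 0 := by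
    refine sum_comm.trans (sum_eq_zero fun b _ => ?_)
    simp only [hκ.antisymm _ b, neg_mul, sum_neg_distrib, neg_eq_zero]
    exact hκ.sum_sum_mul_mul_det_arcMatrix_eq_zero p (by decide) b
      fun a d => (update_eq b a d).2.2.1
  have h₁₃ : ∑ a, ∑ b, ∑ c, κ a b * κ c b * (arcMatrix R p ![a, b, c, b]).det = 0 := by
    refine sum_comm.trans (sum_eq_zero fun b _ => ?_)
    simp only [hκ.antisymm _ b, neg_mul_neg]
    exact hκ.sum_sum_mul_mul_det_arcMatrix_eq_zero p (by decide) b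
      fun a d => (update_eq b a d).2.2.2
  have hpairs : ∑ a, ∑ b, κ a b * κ a b * (arcMatrix R p ![a, b, a, b]).det +
      ∑ a, ∑ b, κ a b * κ b a * (arcMatrix R p ![a, b, b, a]).det = 0 := by
    rw [← hκ.sum_sum_sq_mul_det_sub_det_eq_zero p]
    simp only [← sum_add_distrib]
    refine sum_congr rfl fun a _ => sum_congr rfl fun b _ => ?_
    rw [hκ.antisymm b a]
    ring
  rw [sum_injective_fin_four (by simp [hκ.self]) (by simp [hκ.self]),
    hκ.sum_mul_det_arcMatrix_four]
  simp [h₀₂, h₀₃, h₁₂, h₁₃, hpairs]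

theorem sum_injective_mul_det_arcMatrix_three {H : R} (hH : ∀ a, ∑ b, κ a b ^ 2 = H)
    (p : Fin 3 → V) :
    ∑ a : Fin 3 → V with Injective a, κ (a 0) (a 1) * κ (a 1) (a 2) * (arcMatrix R p a).det =
      (Fintype.card V - 3) * H := by
  have update_eq : ∀ a b c : V, ![b, a, c] = update (update (fun _ => a) 0 b) 2 c :=
    fun a b c => by ext i; fin_cases i <;> rfl
  have hzero : ∑ a, ∑ b, ∑ c, κ a b * κ b c * (arcMatrix R p ![a, b, c]).det = 0 := by
    refine sum_comm.trans (sum_eq_zero fun b _ => ?_)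
    simp only [hκ.antisymm _ b, neg_mul, sum_neg_distrib, neg_eq_zero]
    exact hκ.sum_sum_mul_mul_det_arcMatrix_eq_zero p (by decide) b fun a c => update_eq b a c
  have hpairs : ∑ a, ∑ b, κ a b * κ b a * (arcMatrix R p ![a, b, a]).det =
      -((Fintype.card V - 3) * H) := by
    rw [← sum_sum_mul_det_arcMatrix_three (fun a b => by rw [hκ.antisymm, neg_sq]) hH p]
    simp only [← sum_neg_distrib]
    refine sum_congr rfl fun a _ => sum_congr rfl fun b _ => ?_
    rw [hκ.antisymm b a]
    ring
  rw [sum_injective_fin_three (by simp [hκ.self]) (by simp [hκ.self]), sum_fin_three_pi]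
  simp [hzero, hpairs]

theorem sum_cyclesOn_apply {p q : V} (hpq : p ≠ q) (hV : 2 < Fintype.card V) :
    ∑ ν ∈ cyclesOn univ, κ (ν p) (ν q) =
      ((Fintype.card V - 3).factorial : R) * (2 * κ p q) := by
  have hsum := sum_cyclesOn_comp (R := R) (injective_pair_iff_ne.2 hpq) hV
    fun a => κ (a 0) (a 1)
  rw [sum_injective_fin_two (by simp [hκ.self]), hκ.sum_mul_det_arcMatrix_two] at hsum
  exact hsum

theorem sum_cyclesOn_sq_apply {H : R} (hH : ∀ a, ∑ b, κ a b ^ 2 = H) {p q : V} (hpq : p ≠ q)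
    (hV : 2 < Fintype.card V) :
    ∑ ν ∈ cyclesOn univ, κ (ν p) (ν q) ^ 2 = ((Fintype.card V - 2).factorial : R) * H := by
  have hsum := sum_cyclesOn_comp (R := R) (injective_pair_iff_ne.2 hpq) hV
    fun a => κ (a 0) (a 1) ^ 2
  have hdet := sum_sum_mul_det_arcMatrix_two (fun a b => by rw [hκ.antisymm, neg_sq]) hH ![p, q]
  rw [sum_injective_fin_two (by simp [hκ.self]), sum_fin_two_pi] at hsum
  rw [← cast_factorial_sub_sub_one_mul hV, mul_assoc, Nat.cast_two, ← hdet]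
  exact hsum

theorem sum_cyclesOn_apply_mul_apply {H : R} (hH : ∀ a, ∑ b, κ a b ^ 2 = H) {p q r : V}
    (hpqr : p ≠ q ∧ p ≠ r ∧ q ≠ r) (hV : 3 < Fintype.card V) :
    ∑ ν ∈ cyclesOn univ, κ (ν p) (ν q) * κ (ν q) (ν r) =
      ((Fintype.card V - 3).factorial : R) * H := by
  have hsum := sum_cyclesOn_comp (R := R) (injective_fin_three_iff.2 hpqr) hV
    fun a => κ (a 0) (a 1) * κ (a 1) (a 2)
  rw [hκ.sum_injective_mul_det_arcMatrix_three hH, ← mul_assoc, ← Nat.cast_ofNat (n := 3),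
    cast_factorial_sub_sub_one_mul hV] at hsum
  exact hsum

theorem sum_cyclesOn_apply_mul_apply_of_disjoint {p q r t : V}
    (hpqrt : p ≠ q ∧ p ≠ r ∧ p ≠ t ∧ q ≠ r ∧ q ≠ t ∧ r ≠ t) (hV : 4 < Fintype.card V) :
    ∑ ν ∈ cyclesOn univ, κ (ν p) (ν q) * κ (ν r) (ν t) =
      ((Fintype.card V - 5).factorial : R) *
        (8 * (κ p q * κ r t - κ p r * κ q t + κ p t * κ q r)) := by
  have hsum := sum_cyclesOn_comp (R := R) (injective_fin_four_iff.2 hpqrt) hV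
    fun a => κ (a 0) (a 1) * κ (a 2) (a 3)
  rw [hκ.sum_injective_mul_det_arcMatrix_four] at hsum
  exact hsum

end IsBalancedKernel

end Kernels

section CyclicDistance

variable {n : ℕ}

/-- The signed cyclic distance from `a` to `b`: the representative of `b - a` modulo `n` in
`(0, n)`, shifted by `-n / 2` to make it antisymmetric, and zero if `a = b`. -/
noncomputable def cycDist (a b : Fin n) : ℝ :=
  if a = b then 0 else ((b - a : Fin n) : ℕ) - (n : ℝ) / 2

theorem cycDist_of_lt {a b : Fin n} (h : a < b) : cycDist a b = (b : ℝ) - a - n / 2 := by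
  rw [cycDist, if_neg h.ne, Fin.sub_val_of_le h.le, Nat.cast_sub (Fin.le_def.1 h.le)]

theorem cycDist_of_gt {a b : Fin n} (h : b < a) : cycDist a b = (b : ℝ) - a + n / 2 := by
  rw [cycDist, if_neg h.ne', Fin.coe_sub_iff_lt.2 h, Nat.cast_sub (by omega)]
  push_cast
  ring

theorem cycDist_self (a : Fin n) : cycDist a a = 0 := if_pos rfl

theorem cycDist_antisymm (a b : Fin n) : cycDist a b = -cycDist b a := by
  obtain h | rfl | h := lt_trichotomy a b
  · rw [cycDist_of_lt h, cycDist_of_gt h]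
    ring
  · rw [cycDist_self, neg_zero]
  · rw [cycDist_of_lt h, cycDist_of_gt h]
    ring

theorem sum_comp_cycDist {m : ℕ} (a : Fin (m + 1)) {f : ℝ → ℝ} (hf : f 0 = 0) :
    ∑ b, f (cycDist a b) = ∑ j ∈ range m, f ((j + 1 : ℕ) - ((m + 1 : ℕ) : ℝ) / 2) := by
  rw [← Equiv.sum_comp (Equiv.addLeft a), Fin.sum_univ_succ, ← Fin.sum_univ_eq_sum_range
    fun j => f ((j + 1 : ℕ) - ((m + 1 : ℕ) : ℝ) / 2)]
  simp [cycDist, hf]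

theorem sum_range_succ_sub (m : ℕ) (c : ℝ) :
    ∑ j ∈ range m, (((j + 1 : ℕ) : ℝ) - c) = m * (m + 1) / 2 - m * c := by
  induction m with
  | zero => simp
  | succ m ih =>
    rw [sum_range_succ, ih]
    push_cast
    ring

theorem sum_range_succ_sub_sq (m : ℕ) (c : ℝ) :
    ∑ j ∈ range m, (((j + 1 : ℕ) : ℝ) - c) ^ 2 =
      m * (m + 1) * (2 * m + 1) / 6 - c * (m * (m + 1)) + m * c ^ 2 := by
  induction m with
  | zero => simp
  | succ m ih =>
    rw [sum_range_succ, ih]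
    push_cast
    ring

theorem sum_cycDist (a : Fin n) : ∑ b, cycDist a b = 0 := by
  cases n with
  | zero => exact a.elim0
  | succ m =>
    rw [sum_comp_cycDist a (f := fun x => x) rfl, sum_range_succ_sub]
    push_cast
    ring

theorem sum_cycDist_sq (a : Fin n) :
    ∑ b, cycDist a b ^ 2 = (n : ℝ) * (n - 1) * (n - 2) / 12 := by
  cases n with
  | zero => exact a.elim0
  | succ m =>
    rw [sum_comp_cycDist a (f := (· ^ 2)) (zero_pow two_ne_zero), sum_range_succ_sub_sq]
    push_cast
    ring

theorem isBalancedKernel_cycDist : IsBalancedKernel (cycDist (n := n)) :=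
  ⟨cycDist_self, cycDist_antisymm, sum_cycDist⟩

theorem val_finRotate (i : Fin n) :
    (i : ℕ) + 1 < n ∧ (finRotate n i : ℕ) = i + 1 ∨ (i : ℕ) + 1 = n ∧ (finRotate n i : ℕ) = 0 := by
  cases n with
  | zero => exact i.elim0
  | succ m =>
    obtain rfl | h := eq_or_ne i (Fin.last m)
    · simp
    · rw [coe_finRotate_of_ne_last h]
      have := Fin.val_lt_last h
      omega

theorem finRotate_ne_self (hn : 2 ≤ n) (i : Fin n) : finRotate n i ≠ i := by
  have := val_finRotate i
  rw [Fin.ne_iff_vne]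
  omega

theorem finRotate_finRotate_ne_self (hn : 3 ≤ n) (i : Fin n) :
    finRotate n (finRotate n i) ≠ i := by
  have := val_finRotate i
  have := val_finRotate (finRotate n i)
  rw [Fin.ne_iff_vne]
  omega

theorem cycDist_finRotate (hn : 2 ≤ n) (i : Fin n) :
    cycDist i (finRotate n i) = 1 - (n : ℝ) / 2 := by
  obtain ⟨_, h⟩ | ⟨hi, h⟩ := val_finRotate i
  · rw [cycDist_of_lt (Fin.lt_def.2 (by omega)), h]
    push_cast
    ring
  · have hn_cast : (n : ℝ) = i + 1 := by exact_mod_cast hi.symm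
    rw [cycDist_of_gt (Fin.lt_def.2 (by omega)), h, hn_cast]
    push_cast
    ring

theorem cycDist_pfaffian_of_lt {i j : Fin n} (hij : i < j) (hj : j ≠ finRotate n i)
    (hi : i ≠ finRotate n j) :
    cycDist i (finRotate n i) * cycDist j (finRotate n j)
      - cycDist i j * cycDist (finRotate n i) (finRotate n j)
      + cycDist i (finRotate n j) * cycDist (finRotate n i) j = (n : ℝ) * (n - 4) / 4 := by
  have hn : 2 ≤ n := by have := j.isLt; rw [Fin.lt_def] at hij; omega
  rw [cycDist_finRotate hn, cycDist_finRotate hn, cycDist_of_lt hij]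
  rw [Fin.ne_iff_vne] at hj hi
  rw [Fin.lt_def] at hij
  obtain ⟨_, hi_succ⟩ : (i : ℕ) + 1 < n ∧ (finRotate n i : ℕ) = i + 1 := by
    have := val_finRotate i
    omega
  rw [cycDist_of_lt (a := finRotate n i) (b := j) (Fin.lt_def.2 (by omega)), hi_succ]
  obtain ⟨_, hj_succ⟩ | ⟨hj', hj_succ⟩ := val_finRotate j
  · rw [cycDist_of_lt (Fin.lt_def.2 (by omega)), cycDist_of_lt (Fin.lt_def.2 (by omega)), hi_succ,
      hj_succ]
    push_cast
    ring
  · have hn_cast : (n : ℝ) = j + 1 := by exact_mod_cast hj'.symm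
    rw [cycDist_of_gt (Fin.lt_def.2 (by omega)), cycDist_of_gt (Fin.lt_def.2 (by omega)), hi_succ,
      hj_succ, hn_cast]
    push_cast
    ring

theorem cycDist_pfaffian {i j : Fin n} (hij : i ≠ j) (hj : j ≠ finRotate n i)
    (hi : i ≠ finRotate n j) :
    cycDist i (finRotate n i) * cycDist j (finRotate n j)
      - cycDist i j * cycDist (finRotate n i) (finRotate n j)
      + cycDist i (finRotate n j) * cycDist (finRotate n i) j = (n : ℝ) * (n - 4) / 4 := by
  obtain h | h := lt_or_gt_of_ne hij
  · exact cycDist_pfaffian_of_lt h hj hi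
  · rw [← cycDist_pfaffian_of_lt h hi hj, cycDist_antisymm i j,
      cycDist_antisymm (finRotate n i) (finRotate n j), cycDist_antisymm i (finRotate n j),
      cycDist_antisymm (finRotate n i) j]
    ring

/-- The signed cyclic distance between the consecutive values `ν i` and `ν (i + 1)`. -/
noncomputable def stepDist (ν : Perm (Fin n)) (i : Fin n) : ℝ :=
  cycDist (ν i) (ν (finRotate n i))

theorem stepDist_eq (hn : 2 ≤ n) (ν : Perm (Fin n)) (i : Fin n) :
    stepDist ν i = (ν (finRotate n i) : ℝ) - ν i - n / 2 +
      n * if ν i > ν (finRotate n i) then 1 else 0 := by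
  obtain h | h := lt_or_gt_of_ne (ν.injective.ne (finRotate_ne_self hn i))
  · rw [stepDist, cycDist_of_gt h, if_pos h]
    ring
  · rw [stepDist, cycDist_of_lt h, if_neg h.not_gt]
    ring

theorem sum_stepDist (hn : 2 ≤ n) (ν : Perm (Fin n)) :
    ∑ i, stepDist ν i = n * ((degree ν : ℝ) - n / 2) := by
  have hshift : ∑ i, (ν (finRotate n i) : ℝ) = ∑ i, (ν i : ℝ) :=
    Equiv.sum_comp (finRotate n) fun i => (ν i : ℝ)
  simp only [stepDist_eq hn, sum_add_distrib, sum_sub_distrib, hshift, sub_self, ← mul_sum,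
    sum_boole, sum_const, card_univ, Fintype.card_fin, nsmul_eq_mul, degree]
  ring

end CyclicDistance

section Moments

theorem sum_eq_add_add_add_card_sub_three_mul {V R : Type*} [Fintype V] [CommRing R]
    {x y z : V} (hxyz : x ≠ y ∧ x ≠ z ∧ y ≠ z) {f : V → R} {C : R}
    (hf : ∀ w, w ≠ x → w ≠ y → w ≠ z → f w = C) :
    ∑ w, f w = f x + f y + f z + (Fintype.card V - 3) * C := by
  classical
  obtain ⟨hxy, hxz, hyz⟩ := hxyz
  have sum_sub : ∑ w, (f w - C) = (f x - C) + (f y - C) + (f z - C) := by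
    rw [← sum_subset (subset_univ {x, y, z}), sum_insert (by simp [hxy, hxz]), sum_pair hyz,
      add_assoc]
    intro w _ hw
    simp only [mem_insert, mem_singleton, not_or] at hw
    rw [hf w hw.1 hw.2.1 hw.2.2, sub_self]
  rw [sum_sub_distrib, sum_const, card_univ, nsmul_eq_mul] at sum_sub
  linear_combination sum_sub

variable {n : ℕ}

theorem sum_cyclesOn_stepDist (hn : 3 ≤ n) (i : Fin n) :
    ∑ ν ∈ cyclesOn univ, stepDist ν i = -((n - 2).factorial : ℝ) := by
  have hstep := isBalancedKernel_cycDist.sum_cyclesOn_apply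
    (finRotate_ne_self (by omega) i).symm (hn.trans_eq (Fintype.card_fin n).symm)
  have hfactorial := cast_factorial_sub_sub_one_mul (R := ℝ) (show 2 < n from hn)
  rw [cycDist_finRotate (by omega), Fintype.card_fin] at hstep
  rw [← hfactorial]
  refine hstep.trans ?_
  rw [show n - 3 = n - 2 - 1 by omega]
  push_cast
  ring

theorem sum_cyclesOn_stepDist_sq (hn : 3 ≤ n) (i : Fin n) :
    ∑ ν ∈ cyclesOn univ, stepDist ν i ^ 2 =
      ((n - 2).factorial : ℝ) * (n * (n - 1) * (n - 2) / 12) := by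
  simpa only [stepDist, Fintype.card_fin] using isBalancedKernel_cycDist.sum_cyclesOn_sq_apply
    sum_cycDist_sq (finRotate_ne_self (by omega) i).symm (hn.trans_eq (Fintype.card_fin n).symm)

theorem sum_cyclesOn_stepDist_mul_stepDist_finRotate (hn : 4 ≤ n) (i : Fin n) :
    ∑ ν ∈ cyclesOn univ, stepDist ν i * stepDist ν (finRotate n i) =
      ((n - 3).factorial : ℝ) * (n * (n - 1) * (n - 2) / 12) := by
  simpa only [stepDist, Fintype.card_fin] using
    isBalancedKernel_cycDist.sum_cyclesOn_apply_mul_apply sum_cycDist_sq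
      ⟨(finRotate_ne_self (by omega) i).symm,
        (finRotate_finRotate_ne_self (by omega) i).symm,
        (finRotate_ne_self (by omega) _).symm⟩ (hn.trans_eq (Fintype.card_fin n).symm)

theorem sum_cyclesOn_stepDist_mul_stepDist (hn : 5 ≤ n) {i j : Fin n} (hij : i ≠ j)
    (hj : j ≠ finRotate n i) (hi : i ≠ finRotate n j) :
    ∑ ν ∈ cyclesOn univ, stepDist ν i * stepDist ν j =
      ((n - 5).factorial : ℝ) * (2 * n * (n - 4)) := by
  have hstep := isBalancedKernel_cycDist.sum_cyclesOn_apply_mul_apply_of_disjoint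
    ⟨(finRotate_ne_self (by omega) i).symm, hij, hi, hj.symm, (finRotate n).injective.ne hij,
      (finRotate_ne_self (by omega) j).symm⟩ (hn.trans_eq (Fintype.card_fin n).symm)
  rw [cycDist_pfaffian hij hj hi, Fintype.card_fin] at hstep
  refine hstep.trans ?_
  ring

theorem sum_sum_cyclesOn_stepDist_mul_stepDist (hn : 5 ≤ n) (i : Fin n) :
    ∑ j, ∑ ν ∈ cyclesOn univ, stepDist ν i * stepDist ν j =
      (((n - 2).factorial : ℝ) + 2 * (n - 3).factorial) * (n * (n - 1) * (n - 2) / 12) +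
        (n - 3) * ((n - 5).factorial * (2 * n * (n - 4))) := by
  obtain ⟨k, rfl⟩ := (finRotate n).surjective i
  have hne : finRotate n k ≠ finRotate n (finRotate n k) ∧ finRotate n k ≠ k ∧
      finRotate n (finRotate n k) ≠ k :=
    ⟨(finRotate_ne_self (by omega) _).symm, finRotate_ne_self (by omega) k,
      finRotate_finRotate_ne_self (by omega) k⟩
  have hprev : ∑ ν ∈ cyclesOn univ, stepDist ν (finRotate n k) * stepDist ν k =
      ((n - 3).factorial : ℝ) * (n * (n - 1) * (n - 2) / 12) := by
    simp only [mul_comm (stepDist _ (finRotate n k))]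
    exact sum_cyclesOn_stepDist_mul_stepDist_finRotate (by omega) k
  rw [sum_eq_add_add_add_card_sub_three_mul hne fun j hj hj_next hj_prev =>
    sum_cyclesOn_stepDist_mul_stepDist hn hj.symm hj_next
      ((finRotate n).injective.ne hj_prev.symm), hprev,
    sum_cyclesOn_stepDist_mul_stepDist_finRotate (by omega)]
  simp only [← pow_two, sum_cyclesOn_stepDist_sq (show 3 ≤ n by omega), Fintype.card_fin]
  ring

theorem sum_cyclesOn_degree_sub (hn : 3 ≤ n) :
    ∑ ν ∈ cyclesOn (univ : Finset (Fin n)), ((degree ν : ℝ) - n / 2) =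
      -((n - 2).factorial : ℝ) := by
  refine mul_left_cancel₀ (show (n : ℝ) ≠ 0 by positivity) ?_
  rw [mul_sum]
  simp only [← sum_stepDist (show 2 ≤ n by omega)]
  rw [sum_comm]
  simp only [sum_cyclesOn_stepDist hn, sum_const, card_univ, Fintype.card_fin, nsmul_eq_mul]

theorem sum_cyclesOn_degree_sub_sq (hn : 5 ≤ n) :
    ∑ ν ∈ cyclesOn (univ : Finset (Fin n)), ((degree ν : ℝ) - n / 2) ^ 2 =
      ((n - 1).factorial : ℝ) * n / 12 + 2 * (n - 3).factorial := by
  refine mul_left_cancel₀ (show (n : ℝ) ^ 2 ≠ 0 by positivity) ?_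
  calc (n : ℝ) ^ 2 * ∑ ν ∈ cyclesOn (univ : Finset (Fin n)), ((degree ν : ℝ) - n / 2) ^ 2
      = ∑ i : Fin n, ∑ j, ∑ ν ∈ cyclesOn univ, stepDist ν i * stepDist ν j := by
        simp only [mul_sum, ← mul_pow, ← sum_stepDist (show 2 ≤ n by omega)]
        simp only [pow_two, sum_mul_sum]
        rw [sum_comm]
        exact sum_congr rfl fun i _ => sum_comm
    _ = n * ((((n - 2).factorial : ℝ) + 2 * (n - 3).factorial) * (n * (n - 1) * (n - 2) / 12) +
          (n - 3) * ((n - 5).factorial * (2 * n * (n - 4)))) := by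
        simp only [sum_sum_cyclesOn_stepDist_mul_stepDist hn, sum_const, card_univ,
          Fintype.card_fin, nsmul_eq_mul]
    _ = n ^ 2 * (((n - 1).factorial : ℝ) * n / 12 + 2 * (n - 3).factorial) := by
        obtain ⟨m, rfl⟩ : ∃ m, n = m + 5 := ⟨n - 5, by omega⟩
        simp only [Nat.reduceSubDiff, add_tsub_cancel_right, Nat.factorial_succ]
        push_cast
        ring

end Moments

section DegreeRange

variable {n : ℕ} {ν : Perm (Fin n)}

theorem nCycles_eq_cyclesOn (hn : 2 ≤ n) : nCycles n = cyclesOn univ := by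
  have : Nontrivial (Fin n) := Fin.nontrivial_iff_two_le.2 hn
  ext ν
  simp only [nCycles, mem_filter, mem_univ, true_and, mem_cyclesOn, coe_univ, not_true_eq_false,
    false_implies, implies_true, and_true]
  constructor
  · rintro ⟨hcycle, hsupport⟩
    simpa [← coe_support_eq_set_support, hsupport] using hcycle.isCycleOn
  · intro hν
    have hmoved : ∀ x, ν x ≠ x := fun x => hν.apply_ne Set.nontrivial_univ (Set.mem_univ x)
    refine ⟨⟨⟨0, by omega⟩, hmoved _, fun y _ => hν.2 (Set.mem_univ _) (Set.mem_univ y)⟩, ?_⟩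
    exact eq_univ_of_forall fun x => mem_support.2 (hmoved x)

theorem card_nCycles (hn : 2 ≤ n) : #(nCycles n) = (n - 1).factorial := by
  have : Nonempty (Fin n) := ⟨⟨0, by omega⟩⟩
  rw [nCycles_eq_cyclesOn hn, card_cyclesOn univ_nonempty, card_univ, Fintype.card_fin]

theorem one_le_degree (hn : 2 ≤ n) (ν : Perm (Fin n)) : 1 ≤ degree ν := by
  have : NeZero n := ⟨by omega⟩
  refine card_pos.2 ⟨ν.symm ⊤, mem_filter.2 ⟨mem_univ _, ?_⟩⟩
  rw [apply_symm_apply]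
  refine lt_top_iff_ne_top.2 fun h => finRotate_ne_self hn (ν.symm ⊤)
    ((eq_symm_apply ν).2 h)

theorem cycDist_le (hn : 2 ≤ n) (a b : Fin n) : cycDist a b ≤ (n : ℝ) / 2 - 1 := by
  have hn' : (2 : ℝ) ≤ n := by exact_mod_cast hn
  rw [cycDist]
  split_ifs
  · linarith
  · have hlt : (((b - a : Fin n) : ℕ) : ℝ) + 1 ≤ n := by exact_mod_cast (b - a).isLt
    linarith

theorem add_one_eq_of_cycDist_eq {m : ℕ} (hm : 2 ≤ m) {a b : Fin (m + 1)}
    (h : cycDist a b = ((m + 1 : ℕ) : ℝ) / 2 - 1) : b + 1 = a := by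
  have hm' : (2 : ℝ) ≤ m := by exact_mod_cast hm
  push_cast [cycDist] at h
  split_ifs at h
  · linarith
  · have hval : b - a = Fin.last m := by
      have hcast : (((b - a : Fin (m + 1)) : ℕ) : ℝ) = m := by linarith
      exact Fin.ext (by exact_mod_cast hcast)
    rw [sub_eq_iff_eq_add.1 hval, add_right_comm, Fin.last_add_one, zero_add]

theorem apply_apply_of_apply_add_one {m : ℕ} {ν : Fin (m + 1) → Fin (m + 1)}
    (h : ∀ i, ν (i + 1) + 1 = ν i) (x : Fin (m + 1)) : ν (ν x) = x := by
  have add_self_eq : ∀ i, ν i + i = ν 0 := fun i => by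
    induction i using Fin.induction with
    | zero => rw [add_zero]
    | succ i ih => rw [← ih, ← h i.castSucc, Fin.coeSucc_eq_succ, add_assoc, add_comm 1,
        Fin.coeSucc_eq_succ]
  rw [eq_sub_of_add_eq (add_self_eq (ν x)), ← add_self_eq x, add_sub_cancel_left]

theorem degree_le_of_mem_nCycles (hn : 3 ≤ n) (hν : ν ∈ nCycles n) : degree ν ≤ n - 2 := by
  by_contra! hlt
  obtain ⟨m, rfl⟩ : ∃ m, n = m + 1 := ⟨n - 1, by omega⟩
  have hdegree : ((m + 1 : ℕ) : ℝ) ≤ degree ν + 1 := by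
    exact_mod_cast (by omega : m + 1 ≤ degree ν + 1)
  have stepDist_eq_max : ∀ i ∈ univ, stepDist ν i = ((m + 1 : ℕ) : ℝ) / 2 - 1 := by
    have hle : ∀ i ∈ univ, stepDist ν i ≤ ((m + 1 : ℕ) : ℝ) / 2 - 1 :=
      fun i _ => cycDist_le (by omega) _ _
    refine (sum_eq_sum_iff_of_le hle).1 (le_antisymm (sum_le_sum hle) ?_)
    rw [sum_stepDist (by omega), sum_const, card_univ, Fintype.card_fin, nsmul_eq_mul]
    gcongr ?_ * ?_
    linarith
  have apply_add_one : ∀ i, ν (i + 1) + 1 = ν i := fun i => by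
    rw [← finRotate_apply i]
    exact add_one_eq_of_cycDist_eq (by omega) (stepDist_eq_max i (mem_univ i))
  have hinvol : ν ^ 2 = 1 := by
    rw [pow_two]
    exact Perm.ext (apply_apply_of_apply_add_one apply_add_one)
  simp only [nCycles, mem_filter, mem_univ, true_and] at hν
  have horder : orderOf ν = m + 1 := by
    rw [hν.1.orderOf, hν.2, card_univ, Fintype.card_fin]
  have := Nat.le_of_dvd two_pos (orderOf_dvd_of_pow_eq_one hinvol)
  omega

theorem sum_Icc_mul_N (hn : 3 ≤ n) (f : ℕ → ℝ) :
    ∑ d ∈ Icc 1 (n - 2), f d * (N n d : ℝ) = ∑ ν ∈ nCycles n, f (degree ν) := by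
  rw [← sum_fiberwise_of_maps_to (g := degree) (t := Icc 1 (n - 2))
    fun ν hν => mem_Icc.2 ⟨one_le_degree (by omega) ν, degree_le_of_mem_nCycles hn hν⟩]
  refine sum_congr rfl fun d _ => ?_
  rw [sum_congr rfl fun ν hν => by rw [(mem_filter.1 hν).2], sum_const, nsmul_eq_mul, mul_comm, N]

end DegreeRange

section UniformCycle

variable {n : ℕ}

theorem integral_uniformCycle (hn : 2 ≤ n) (f : Perm (Fin n) → ℝ) :
    ∫ ν, f ν ∂(uniformCycle n) = 1 / ((n - 1).factorial : ℝ) * ∑ ν ∈ nCycles n, f ν := by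
  have : MeasurableSingletonClass (Perm (Fin n)) := ⟨fun _ => trivial⟩
  rw [uniformCycle, ProbabilityTheory.uniformOn, ProbabilityTheory.cond,
    MeasureTheory.integral_smul_measure,
    MeasureTheory.setIntegral_finset _ (.of_finite (finite_toSet _)),
    MeasureTheory.Measure.count_apply_finset, card_nCycles hn]
  simp

theorem integral_degree_eq_meanDegree (hn : 3 ≤ n) :
    ∫ ν, (degree ν : ℝ) ∂(uniformCycle n) = meanDegree n := by
  rw [integral_uniformCycle (by omega), meanDegree, sum_Icc_mul_N hn (fun d => (d : ℝ))]

theorem variance_degree_eq_varDegree (hn : 3 ≤ n) :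
    ProbabilityTheory.variance (fun ν => (degree ν : ℝ)) (uniformCycle n) = varDegree n := by
  have hmeasurable : Measurable (fun ν : Perm (Fin n) => (degree ν : ℝ)) := fun _ _ => trivial
  rw [ProbabilityTheory.variance_eq_integral hmeasurable.aemeasurable,
    integral_degree_eq_meanDegree hn, integral_uniformCycle (by omega), varDegree,
    sum_Icc_mul_N hn (fun d => ((d : ℝ) - meanDegree n) ^ 2)]

theorem meanDegree_eq (hn : 3 ≤ n) : meanDegree n = (n : ℝ) / 2 - 1 / ((n : ℝ) - 1) := by
  have hcentered := sum_cyclesOn_degree_sub hn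
  rw [← nCycles_eq_cyclesOn (by omega), sum_sub_distrib, sum_const, card_nCycles (by omega),
    nsmul_eq_mul] at hcentered
  rw [meanDegree, sum_Icc_mul_N hn (fun d => (d : ℝ)), eq_add_of_sub_eq hcentered]
  obtain ⟨m, rfl⟩ : ∃ m, n = m + 2 := ⟨n - 2, by omega⟩
  have hsub : ((m + 2 : ℕ) : ℝ) - 1 = m + 1 := by push_cast; ring
  rw [hsub, Nat.add_sub_cancel, show m + 2 - 1 = m + 1 by omega, Nat.factorial_succ]
  push_cast
  field_simp
  ring

theorem varDegree_eq (hn : 5 ≤ n) :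
    varDegree n = (n : ℝ) / 12 + (n : ℝ) / (((n : ℝ) - 1) ^ 2 * ((n : ℝ) - 2)) := by
  have sq_sub_mean : ∀ ν : Perm (Fin n), ((degree ν : ℝ) - (n / 2 - 1 / (n - 1))) ^ 2 =
      ((degree ν : ℝ) - n / 2) ^ 2 + 2 / (n - 1) * ((degree ν : ℝ) - n / 2)
        + (1 / (n - 1)) ^ 2 := fun ν => by ring
  have hsum : ∑ ν ∈ nCycles n, ((degree ν : ℝ) - meanDegree n) ^ 2 =
      ((n - 1).factorial * n / 12 + 2 * (n - 3).factorial) -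
        2 / (n - 1) * (n - 2).factorial + (n - 1).factorial * (1 / (n - 1)) ^ 2 := by
    simp only [meanDegree_eq (show 3 ≤ n by omega), sq_sub_mean, sum_add_distrib, ← mul_sum,
      sum_const, nsmul_eq_mul]
    rw [card_nCycles (by omega), nCycles_eq_cyclesOn (by omega), sum_cyclesOn_degree_sub_sq hn,
      sum_cyclesOn_degree_sub (by omega)]
    ring
  rw [varDegree, sum_Icc_mul_N (by omega) (fun d => ((d : ℝ) - meanDegree n) ^ 2), hsum]
  obtain ⟨m, rfl⟩ : ∃ m, n = m + 3 := ⟨n - 3, by omega⟩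
  have hsub_one : ((m + 3 : ℕ) : ℝ) - 1 = m + 2 := by push_cast; ring
  have hsub_two : ((m + 3 : ℕ) : ℝ) - 2 = m + 1 := by push_cast; ring
  rw [hsub_one, hsub_two, Nat.add_sub_cancel, show m + 3 - 1 = m + 1 + 1 by omega,
    show m + 3 - 2 = m + 1 by omega, Nat.factorial_succ (m + 1), Nat.factorial_succ m]
  push_cast
  field_simp
  ring

end UniformCycle

end CycleDegree

theorem mainTheorem2 (n : ℕ) :
    (3 ≤ n →
      ∫ ν, (CycleDegree.degree ν : ℝ) ∂(CycleDegree.uniformCycle n) = CycleDegree.meanDegree n ∧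
      CycleDegree.meanDegree n = (n : ℝ) / 2 - 1 / ((n : ℝ) - 1)) ∧
    (5 ≤ n →
      ProbabilityTheory.variance (fun ν => (CycleDegree.degree ν : ℝ))
          (CycleDegree.uniformCycle n) = CycleDegree.varDegree n ∧
      CycleDegree.varDegree n =
        (n : ℝ) / 12 + (n : ℝ) / (((n : ℝ) - 1) ^ 2 * ((n : ℝ) - 2))) :=
  ⟨fun hn => ⟨CycleDegree.integral_degree_eq_meanDegree hn, CycleDegree.meanDegree_eq hn⟩,
    fun hn => ⟨CycleDegree.variance_degree_eq_varDegree (by omega), CycleDegree.varDegree_eq hn⟩⟩
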